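/- Let $\xi_1,\xi_2,\dots$ be independent random variables on a probability space, each taking values in $\{1,2,3,\dots\}$, with arbitrary (not necessarily identical) distributions, and let $$\xi=\overline{O}^1(\xi_1,\xi_2,\dots):=\sum_{n=1}^{\infty}\frac{(-1)^{n-1}}{\xi_1(\xi_1+\xi_2)\cdots(\xi_1+\xi_2+\dots+\xi_n)}.$$ Then the distribution $\mu$ of $\xi$ on $\mathbb{R}$ is of pure type: exactly one of the following holds. 1. $\mu$ is purely discrete, i.e. $\mu(\mathbb{R}\setminus D)=0$ for some at most countable set $D$. 2. $\mu$ is purely singular continuous, i.e. $\mu(\{x\})=0$ for every $x\in\mathbb{R}$ and $\mu$ is concentrated on a set of Lebesgue measure $0$. 3. $\mu$ is purely absolutely continuous with respect to Lebesgue measure, i.e. $\mu(E)=0$ for every Borel set $E$ of Lebesgue measure $0$. -/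

import Mathlib

open MeasureTheory ProbabilityTheory Filter Topology

noncomputable section

/-- The partial sum `g₁ + g₂ + ⋯ + gₙ₊₁` of a sequence of symbols; the sequence is indexed from `0`,
so that `g k` is the symbol number `k + 1`. -/
def symbolSum (g : ℕ → ℕ) (n : ℕ) : ℕ := ∑ i ∈ Finset.range (n + 1), g i

/-- The `(n + 1)`-st term
`(-1)ⁿ / (g₁ (g₁ + g₂) ⋯ (g₁ + ⋯ + gₙ₊₁))` of the first Ostrogradsky series. -/
def ostrogradskyTerm (g : ℕ → ℕ) (n : ℕ) : ℝ :=
  (-1) ^ n / ∏ k ∈ Finset.range (n + 1), (symbolSum g k : ℝ)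

/-- The real number `Ō¹(g₁, g₂, …)`, the sum of the first Ostrogradsky series
`1 / g₁ - 1 / (g₁ (g₁ + g₂)) + 1 / (g₁ (g₁ + g₂) (g₁ + g₂ + g₃)) - ⋯`. -/
def barO1 (g : ℕ → ℕ) : ℝ := ∑' n, ostrogradskyTerm g n

/-- The measure is concentrated on an at most countable set. -/
def IsPurelyDiscrete (μ : Measure ℝ) : Prop :=
  ∃ D : Set ℝ, D.Countable ∧ μ Dᶜ = 0

/-- The measure has no atoms and is concentrated on a Lebesgue null set. -/
def IsPurelySingularContinuous (μ : Measure ℝ) : Prop :=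
  (∀ x : ℝ, μ {x} = 0) ∧ μ ⟂ₘ (volume : Measure ℝ)

/-- Every Lebesgue null set is a null set of the measure. -/
def IsPurelyAbsolutelyContinuous (μ : Measure ℝ) : Prop :=
  μ ≪ (volume : Measure ℝ)

/-- The Ostrogradsky series of positive symbols converges (absolutely). -/
theorem summable_ostrogradskyTerm {g : ℕ → ℕ} (hg : ∀ k, 0 < g k) :
    Summable (ostrogradskyTerm g) := by
  have hs : ∀ k, k + 1 ≤ symbolSum g k := fun k => by
    have h := Finset.card_nsmul_le_sum (Finset.range (k + 1)) g 1 (fun i _ => hg i)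
    simpa [symbolSum] using h
  have hp : ∀ n, (((n + 1).factorial : ℕ) : ℝ) ≤
      ∏ k ∈ Finset.range (n + 1), (symbolSum g k : ℝ) := fun n => by
    rw [← Finset.prod_range_add_one_eq_factorial]
    push_cast
    refine Finset.prod_le_prod (fun i _ => by positivity) (fun i _ => ?_)
    exact_mod_cast hs i
  have hf : Summable fun n : ℕ => (1 : ℝ) / ((n + 1).factorial : ℝ) := by
    have h := (summable_nat_add_iff 1).2 (Real.summable_pow_div_factorial 1)
    simpa using h
  refine Summable.of_norm_bounded hf (fun n => ?_)
  have h0 : (0 : ℝ) < ((n + 1).factorial : ℝ) := by exact_mod_cast Nat.factorial_pos _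
  have h1 : ‖ostrogradskyTerm g n‖ = 1 / ∏ k ∈ Finset.range (n + 1), (symbolSum g k : ℝ) := by
    rw [ostrogradskyTerm, norm_div, norm_pow, norm_neg, norm_one, one_pow, Real.norm_of_nonneg]
    exact h0.le.trans (hp n)
  rw [h1]
  exact one_div_le_one_div_of_le h0 (hp n)

/-- A number with random positive symbols is a random variable, so its law is the push-forward. -/
theorem aemeasurable_barO1 {Ω : Type*} [MeasurableSpace Ω] {P : Measure Ω} {ξ : ℕ → Ω → ℕ}
    (hmeas : ∀ k, Measurable (ξ k)) (hpos : ∀ k, ∀ᵐ ω ∂P, 0 < ξ k ω) :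
    AEMeasurable (fun ω => barO1 (fun k => ξ k ω)) P := by
  refine aemeasurable_of_tendsto_metrizable_ae atTop
    (f := fun N ω => ∑ n ∈ Finset.range N, ostrogradskyTerm (fun k => ξ k ω) n) ?_ ?_
  · intro N
    refine Measurable.aemeasurable ?_
    refine Finset.measurable_fun_sum _ (fun n _ => ?_)
    unfold ostrogradskyTerm symbolSum
    refine measurable_const.div (Finset.measurable_fun_prod _ (fun k _ => ?_))
    exact measurable_from_nat.comp (Finset.measurable_fun_sum _ (fun i _ => hmeas i))
  · filter_upwards [ae_all_iff.2 hpos] with ω hω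
    exact (summable_ostrogradskyTerm hω).hasSum.tendsto_sum_nat

end

/-! The proof is a zero-one argument. Deleting the first `m` symbols, with sum `s`, turns the series
into one whose partial sums start from the offset `s`; the two values differ by a rational affine
map (`exists_offsetO1_eq_affine`). The offset is not a tail quantity, so tail events are formed by
allowing every offset (`tailSet`), and Kolmogorov's law applies. For a σ-ideal stable under rational
affine maps and offset changes, each measurable member is therefore either `μ`-null or accompanied
by a member carrying all of `μ` (`IsOffsetInvariantIdeal.zero_or_concentrated`). The countable sets
separate the discrete case; the Lebesgue null sets separate singular from absolutely continuous. The
analytic core is that offset changes preserve null sets (`volume_offsetO1_change_eq_zero`). They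
distort cylinder lengths by a factor controlled by the sum of the inverse partial sums of the
symbols (`symbolLength_le_mul_exp`), and that sum is finite almost everywhere because its Lebesgue
mean is bounded (`tsum_symbolLength_mul_inverseSum_le`). -/

open MeasureTheory ProbabilityTheory Filter Topology

noncomputable section

/-! ### Series with an offset and their shift recursion. -/

/-- The symbols `s + u 0 + 1, u 1 + 1, u 2 + 1, …`; all of them are positive. -/
def offsetSymbols (s : ℕ) (u : ℕ → ℕ) : ℕ → ℕ
  | 0 => s + u 0 + 1
  | k + 1 => u (k + 1) + 1

/-- The first Ostrogradsky series whose partial sums of symbols are `s + (u 0 + 1) + ⋯ + (u n + 1)`. -/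
def offsetO1 (s : ℕ) (u : ℕ → ℕ) : ℝ := barO1 (offsetSymbols s u)

/-- The sequence without its first `m` members. -/
def dropSeq (m : ℕ) (u : ℕ → ℕ) : ℕ → ℕ := fun k => u (m + k)

theorem offsetSymbols_pos (s : ℕ) (u : ℕ → ℕ) (k : ℕ) : 0 < offsetSymbols s u k := by
  cases k <;> simp [offsetSymbols]

theorem symbolSum_offsetSymbols (s : ℕ) (u : ℕ → ℕ) (n : ℕ) :
    symbolSum (offsetSymbols s u) n = s + ∑ i ∈ Finset.range (n + 1), (u i + 1) := by
  induction n with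
  | zero => simp [symbolSum, offsetSymbols, add_assoc]
  | succ n ih =>
    rw [symbolSum, Finset.sum_range_succ, ← symbolSum, ih, Finset.sum_range_succ _ (n + 1),
      offsetSymbols, add_assoc]

theorem symbolSum_offsetSymbols_succ (s : ℕ) (u : ℕ → ℕ) (n : ℕ) :
    symbolSum (offsetSymbols s u) (n + 1) =
      symbolSum (offsetSymbols (s + u 0 + 1) (dropSeq 1 u)) n := by
  rw [symbolSum_offsetSymbols, symbolSum_offsetSymbols, Finset.sum_range_succ']
  simp only [dropSeq, add_comm 1]
  ring

theorem ostrogradskyTerm_offsetSymbols_succ (s : ℕ) (u : ℕ → ℕ) (n : ℕ) :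
    ostrogradskyTerm (offsetSymbols s u) (n + 1) =
      -(1 / ((s + u 0 + 1 : ℕ) : ℝ)) *
        ostrogradskyTerm (offsetSymbols (s + u 0 + 1) (dropSeq 1 u)) n := by
  have h0 : symbolSum (offsetSymbols s u) 0 = s + u 0 + 1 := by
    simp [symbolSum, offsetSymbols]
  rw [ostrogradskyTerm, ostrogradskyTerm, Finset.prod_range_succ', h0, pow_succ]
  simp only [symbolSum_offsetSymbols_succ]
  rw [neg_mul, div_mul_div_comm, one_mul, mul_neg_one, neg_div, mul_comm (Finset.prod _ _)]

theorem offsetO1_eq (s : ℕ) (u : ℕ → ℕ) :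
    offsetO1 s u =
      (1 - offsetO1 (s + u 0 + 1) (dropSeq 1 u)) / ((s + u 0 + 1 : ℕ) : ℝ) := by
  have h0 : ostrogradskyTerm (offsetSymbols s u) 0 = 1 / ((s + u 0 + 1 : ℕ) : ℝ) := by
    simp [ostrogradskyTerm, symbolSum, offsetSymbols]
  rw [offsetO1, barO1, (summable_ostrogradskyTerm (offsetSymbols_pos s u)).tsum_eq_zero_add, h0]
  simp only [ostrogradskyTerm_offsetSymbols_succ]
  rw [tsum_mul_left, ← barO1, ← offsetO1]
  ring

theorem one_sub_mul_offsetO1 (s : ℕ) (u : ℕ → ℕ) :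
    1 - ((s + u 0 + 1 : ℕ) : ℝ) * offsetO1 s u = offsetO1 (s + u 0 + 1) (dropSeq 1 u) := by
  have : ((s + u 0 + 1 : ℕ) : ℝ) ≠ 0 := by positivity
  rw [offsetO1_eq s u]
  field_simp
  ring

theorem offsetO1_pos (s : ℕ) (u : ℕ → ℕ) : 0 < offsetO1 s u := by
  set g := offsetSymbols s u with hg
  set c : ℕ → ℝ := fun n => 1 / ∏ k ∈ Finset.range (n + 1), (symbolSum g k : ℝ) with hc
  have hs : ∀ k, ((k + 1 : ℕ) : ℝ) ≤ symbolSum g k := fun k => by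
    rw [hg, symbolSum_offsetSymbols]
    have h := Finset.card_nsmul_le_sum (Finset.range (k + 1)) (fun i => u i + 1) 1
      (fun i _ => by simp)
    simp only [Finset.card_range, smul_eq_mul, mul_one] at h
    exact_mod_cast h.trans (Nat.le_add_left _ _)
  have hp : ∀ n, 0 < ∏ k ∈ Finset.range (n + 1), (symbolSum g k : ℝ) := fun n =>
    Finset.prod_pos fun k _ => lt_of_lt_of_le (by positivity) (hs k)
  have hsucc : ∀ n, c (n + 1) = c n / symbolSum g (n + 1) := fun n => by
    simp only [hc]
    rw [Finset.prod_range_succ _ (n + 1), div_div]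
  have hanti : Antitone c := antitone_nat_of_succ_le fun n => by
    rw [hsucc]
    refine div_le_self (one_div_pos.2 (hp n)).le (le_trans ?_ (hs (n + 1)))
    exact_mod_cast Nat.succ_pos _
  have hterm : ∀ n, ostrogradskyTerm g n = (-1) ^ n * c n := fun n => by
    simp only [ostrogradskyTerm, hc]
    ring
  have hlim : Tendsto (fun n => ∑ i ∈ Finset.range n, (-1 : ℝ) ^ i * c i) atTop (𝓝 (offsetO1 s u)) := by
    simp only [← hterm]
    exact (summable_ostrogradskyTerm (offsetSymbols_pos s u)).hasSum.tendsto_sum_nat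
  -- The first two terms already give a positive lower bound, since the second partial sum of
  -- symbols exceeds 1.
  have h := hanti.alternating_series_le_tendsto hlim 1
  simp only [Finset.sum_range_succ, Finset.sum_range_zero, mul_one, pow_zero, pow_one, one_mul,
    zero_add, hsucc 0] at h
  refine lt_of_lt_of_le ?_ h
  have h1 : (1 : ℝ) < symbolSum g 1 := lt_of_lt_of_le (by norm_num) (hs 1)
  have := div_lt_self (one_div_pos.2 (hp 0)) h1
  simp only [hc] at this ⊢
  linarith

theorem offsetO1_lt (s : ℕ) (u : ℕ → ℕ) : offsetO1 s u < 1 / ((s : ℝ) + 1) := by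
  rw [offsetO1_eq]
  have h := offsetO1_pos (s + u 0 + 1) (dropSeq 1 u)
  refine div_lt_div₀ (by linarith) ?_ zero_le_one (by positivity)
  push_cast
  have : (0 : ℝ) ≤ u 0 := by positivity
  linarith

theorem measurable_offsetO1 (s : ℕ) : Measurable (offsetO1 s) := by
  have hk : ∀ k, Measurable fun u => offsetSymbols s u k := fun k => by
    cases k with
    | zero => exact (measurable_from_nat (f := fun a => s + a + 1)).comp (measurable_pi_apply 0)
    | succ k => exact (measurable_from_nat (f := fun a => a + 1)).comp (measurable_pi_apply _)
  refine measurable_of_tendsto_metrizable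
    (f := fun N u => ∑ n ∈ Finset.range N, ostrogradskyTerm (offsetSymbols s u) n) ?_ ?_
  · intro N
    refine Finset.measurable_fun_sum _ (fun n _ => ?_)
    unfold ostrogradskyTerm symbolSum
    refine measurable_const.div (Finset.measurable_fun_prod _ (fun k _ => ?_))
    exact measurable_from_nat.comp (Finset.measurable_fun_sum _ (fun i _ => hk i))
  · exact tendsto_pi_nhds.2 fun u =>
      (summable_ostrogradskyTerm (offsetSymbols_pos s u)).hasSum.tendsto_sum_nat

theorem barO1_eq_offsetO1 {g : ℕ → ℕ} (hg : ∀ k, 0 < g k) :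
    barO1 g = offsetO1 0 fun k => g k - 1 := by
  rw [offsetO1]
  congr 1
  funext k
  have := hg k
  cases k <;> simp only [offsetSymbols] <;> omega

/-- Iterates `offsetO1_eq`. Rationality of the coefficients matters: only countably many affine maps
occur, whatever the deleted symbols. -/
theorem exists_offsetO1_eq_affine (m s : ℕ) (u : ℕ → ℕ) :
    ∃ (a b : ℚ) (s' : ℕ), b ≠ 0 ∧ offsetO1 s u = a + b * offsetO1 s' (dropSeq m u) := by
  induction m generalizing s u with
  | zero => exact ⟨0, 1, s, one_ne_zero, by simp [show dropSeq 0 u = u from funext fun k => by simp [dropSeq]]⟩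
  | succ m ih =>
    obtain ⟨a, b, s', hb, h⟩ := ih (s + u 0 + 1) (dropSeq 1 u)
    have hq : ((s + u 0 + 1 : ℕ) : ℚ) ≠ 0 := by positivity
    refine ⟨(1 - a) / (s + u 0 + 1 : ℕ), -b / (s + u 0 + 1 : ℕ), s',
      div_ne_zero (neg_ne_zero.2 hb) hq, ?_⟩
    have hd : dropSeq m (dropSeq 1 u) = dropSeq (m + 1) u := by
      funext k
      simp only [dropSeq]
      congr 1
      ring
    rw [offsetO1_eq, h, hd]
    push_cast
    ring

/-! ### Cylinders and their lengths. -/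

/-- The open interval of the numbers with given offset and first symbols. -/
def symbolCylinder : (n : ℕ) → ℕ → (Fin n → ℕ) → Set ℝ
  | 0, s, _ => Set.Ioo 0 (1 / ((s : ℝ) + 1))
  | n + 1, s, w =>
    (fun x : ℝ => 1 - ((s + w 0 + 1 : ℕ) : ℝ) * x) ⁻¹' symbolCylinder n (s + w 0 + 1) (Fin.tail w)

/-- The length of `symbolCylinder n s w`. -/
def symbolLength : (n : ℕ) → ℕ → (Fin n → ℕ) → ℝ
  | 0, s, _ => 1 / ((s : ℝ) + 1)
  | n + 1, s, w => symbolLength n (s + w 0 + 1) (Fin.tail w) / ((s + w 0 + 1 : ℕ) : ℝ)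

/-- The sum of the inverses of the partial sums of the symbols of a word. -/
def inverseSum : (n : ℕ) → ℕ → (Fin n → ℕ) → ℝ
  | 0, _, _ => 0
  | n + 1, s, w => 1 / ((s + w 0 + 1 : ℕ) : ℝ) + inverseSum n (s + w 0 + 1) (Fin.tail w)

/-- The first `n` members of a sequence. -/
def seqPrefix (n : ℕ) (u : ℕ → ℕ) : Fin n → ℕ := fun i => u i

theorem tail_seqPrefix (n : ℕ) (u : ℕ → ℕ) :
    Fin.tail (seqPrefix (n + 1) u) = seqPrefix n (dropSeq 1 u) := by
  funext i
  simp [Fin.tail, seqPrefix, dropSeq, add_comm]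

theorem symbolLength_pos (n s : ℕ) (w : Fin n → ℕ) : 0 < symbolLength n s w := by
  induction n generalizing s with
  | zero => rw [symbolLength]; positivity
  | succ n ih => exact div_pos (ih _ _) (by positivity)

theorem inverseSum_nonneg (n s : ℕ) (w : Fin n → ℕ) : 0 ≤ inverseSum n s w := by
  induction n generalizing s with
  | zero => rfl
  | succ n ih => exact add_nonneg (by positivity) (ih _ _)

theorem symbolLength_le (n s : ℕ) (w : Fin n → ℕ) :
    symbolLength n s w ≤ 1 / ((s : ℝ) + n + 1) := by
  induction n generalizing s with
  | zero => simp [symbolLength]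
  | succ n ih =>
    rw [symbolLength]
    have h := ih (s + w 0 + 1) (Fin.tail w)
    have h1 : (1 : ℝ) ≤ ((s + w 0 + 1 : ℕ) : ℝ) := by exact_mod_cast Nat.succ_pos _
    refine (div_le_self (symbolLength_pos _ _ _).le h1).trans (h.trans ?_)
    refine one_div_le_one_div_of_le (by positivity) ?_
    push_cast
    have : (0 : ℝ) ≤ w 0 := by positivity
    linarith

theorem measurableSet_symbolCylinder (n s : ℕ) (w : Fin n → ℕ) : MeasurableSet (symbolCylinder n s w) := by
  induction n generalizing s with
  | zero => exact measurableSet_Ioo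
  | succ n ih => exact (by fun_prop : Measurable _) (ih _ _)

theorem volume_symbolCylinder (n s : ℕ) (w : Fin n → ℕ) :
    volume (symbolCylinder n s w) = ENNReal.ofReal (symbolLength n s w) := by
  induction n generalizing s with
  | zero => simp [symbolCylinder, symbolLength]
  | succ n ih =>
    have hq : (0 : ℝ) < ((s + w 0 + 1 : ℕ) : ℝ) := by positivity
    have h1 := Real.volume_preimage_mul_left hq.ne'
      ((fun y : ℝ => 1 - y) ⁻¹' symbolCylinder n (s + w 0 + 1) (Fin.tail w))
    rw [(Measure.measurePreserving_sub_left volume (1 : ℝ)).measure_preimage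
      (measurableSet_symbolCylinder _ _ _).nullMeasurableSet, ih, ← ENNReal.ofReal_mul (abs_nonneg _),
      abs_of_pos (inv_pos.2 hq), inv_mul_eq_div] at h1
    exact h1

theorem abs_sub_le_of_mem_symbolCylinder {n s : ℕ} {w : Fin n → ℕ} {x y : ℝ} (hx : x ∈ symbolCylinder n s w)
    (hy : y ∈ symbolCylinder n s w) : |x - y| ≤ symbolLength n s w := by
  induction n generalizing s x y with
  | zero =>
    simp only [symbolCylinder, Set.mem_Ioo] at hx hy
    rw [symbolLength, abs_le]
    constructor <;> linarith
  | succ n ih =>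
    have hq : (0 : ℝ) < ((s + w 0 + 1 : ℕ) : ℝ) := by positivity
    have h := ih hx hy
    rw [symbolLength, le_div_iff₀ hq]
    rwa [sub_sub_sub_cancel_left, ← mul_sub, abs_mul, abs_of_pos hq, abs_sub_comm, mul_comm] at h

theorem symbolCylinder_subset (n s : ℕ) (w : Fin n → ℕ) :
    symbolCylinder n s w ⊆ Set.Ioo 0 (1 / ((s : ℝ) + 1)) := by
  induction n generalizing s with
  | zero => exact subset_rfl
  | succ n ih =>
    intro x hx
    have h := ih _ _ hx
    have hq : (0 : ℝ) < ((s + w 0 + 1 : ℕ) : ℝ) := by positivity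
    have hsq : (s : ℝ) + 1 ≤ ((s + w 0 + 1 : ℕ) : ℝ) := by
      push_cast
      have : (0 : ℝ) ≤ w 0 := by positivity
      linarith
    have h1 : 1 / (((s + w 0 + 1 : ℕ) : ℝ) + 1) < 1 := by
      rw [div_lt_one (by positivity)]
      linarith
    have h2 : x < 1 / ((s + w 0 + 1 : ℕ) : ℝ) := by
      rw [lt_div_iff₀ hq, mul_comm]
      linarith [h.1]
    exact ⟨pos_of_mul_pos_right (by linarith [h.2]) hq.le,
      h2.trans_le (one_div_le_one_div_of_le (by positivity) hsq)⟩

/-- With `q = s + w 0 + 1`, the remainder `1 - q * x` lies between 0 and `1 / (q + 1)`. These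
intervals are disjoint for distinct `q`, so `x` determines its first symbol. -/
theorem symbolCylinder_succ_subset_Ioo (n s : ℕ) (w : Fin (n + 1) → ℕ) :
    symbolCylinder (n + 1) s w ⊆
      Set.Ioo (1 / (((s + w 0 + 1 : ℕ) : ℝ) + 1)) (1 / ((s + w 0 + 1 : ℕ) : ℝ)) := by
  intro x hx
  have h := symbolCylinder_subset n (s + w 0 + 1) (Fin.tail w) hx
  have hq : (0 : ℝ) < ((s + w 0 + 1 : ℕ) : ℝ) := by positivity
  simp only [Set.mem_Ioo] at h ⊢
  generalize ((s + w 0 + 1 : ℕ) : ℝ) = q at h hq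
  rw [lt_div_iff₀ (by positivity)] at h
  rw [lt_div_iff₀ hq, div_lt_iff₀ (by positivity)]
  refine ⟨?_, by linarith⟩
  have : 0 < q * (x * (q + 1) - 1) := by linarith
  have := pos_of_mul_pos_right this hq.le
  linarith

theorem disjoint_symbolCylinder {n : ℕ} (s : ℕ) {w w' : Fin n → ℕ} (h : w ≠ w') :
    Disjoint (symbolCylinder n s w) (symbolCylinder n s w') := by
  rw [Set.disjoint_left]
  intro x hx hx'
  apply h
  clear h
  induction n generalizing s x with
  | zero => exact Subsingleton.elim _ _
  | succ n ih =>
    have key : ∀ v v' : Fin (n + 1) → ℕ, x ∈ symbolCylinder (n + 1) s v → x ∈ symbolCylinder (n + 1) s v' →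
        v' 0 ≤ v 0 := by
      intro v v' hv hv'
      by_contra! hlt
      have h1 := (symbolCylinder_succ_subset_Ioo _ _ _ hv).1
      have h2 := (symbolCylinder_succ_subset_Ioo _ _ _ hv').2
      refine lt_irrefl _ ((h1.trans h2).trans_le (one_div_le_one_div_of_le (by positivity) ?_))
      exact_mod_cast (by omega : s + v 0 + 1 + 1 ≤ s + v' 0 + 1)
    have h0 : w 0 = w' 0 := le_antisymm (key _ _ hx' hx) (key _ _ hx hx')
    have ht : Fin.tail w = Fin.tail w' := by
      simp only [symbolCylinder, Set.mem_preimage, ← h0] at hx hx'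
      exact ih _ hx hx'
    rw [← Fin.cons_self_tail w, ← Fin.cons_self_tail w', h0, ht]

theorem offsetO1_mem_symbolCylinder (n s : ℕ) (u : ℕ → ℕ) :
    offsetO1 s u ∈ symbolCylinder n s (seqPrefix n u) := by
  induction n generalizing s u with
  | zero => exact ⟨offsetO1_pos s u, offsetO1_lt s u⟩
  | succ n ih =>
    have h := ih (s + u 0 + 1) (dropSeq 1 u)
    rw [← one_sub_mul_offsetO1, ← tail_seqPrefix] at h
    exact h

theorem symbolCylinder_seqPrefix_succ_subset (n s : ℕ) (u : ℕ → ℕ) :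
    symbolCylinder (n + 1) s (seqPrefix (n + 1) u) ⊆ symbolCylinder n s (seqPrefix n u) := by
  induction n generalizing s u with
  | zero => exact symbolCylinder_subset _ _ _
  | succ n ih =>
    intro x hx
    rw [symbolCylinder, tail_seqPrefix] at hx ⊢
    exact ih _ _ hx

theorem offsetO1_injective (s : ℕ) : Function.Injective (offsetO1 s) := by
  intro u v h
  funext k
  by_contra hk
  have hne : seqPrefix (k + 1) u ≠ seqPrefix (k + 1) v := fun e => hk (congrFun e (Fin.last k))
  exact Set.disjoint_left.1 (disjoint_symbolCylinder s hne) (offsetO1_mem_symbolCylinder _ _ _)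
    (h ▸ offsetO1_mem_symbolCylinder _ _ _)

/-! ### Distortion of lengths and the mean of the inverse sum. -/

/-- Corresponding partial sums `p` and `q` satisfy `p ≤ q + s ≤ q * exp (s / q)`; multiplying over
the word gives the exponential, and the last factor of the length gives `1 + s`. The common part `b`
accumulates the symbols already read in the induction. -/
theorem symbolLength_le_mul_exp (n s s' b : ℕ) (w : Fin n → ℕ) :
    symbolLength n (s' + b) w ≤
      (1 + s) * Real.exp (s * inverseSum n (s' + b) w) * symbolLength n (s + b) w := by
  induction n generalizing b with
  | zero =>
    simp only [symbolLength, inverseSum, mul_zero, Real.exp_zero, mul_one]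
    rw [mul_one_div, div_le_div_iff₀ (by positivity) (by positivity)]
    push_cast
    have h1 : (0 : ℝ) ≤ s * s' := by positivity
    have h2 : (0 : ℝ) ≤ s * b := by positivity
    have h3 : (0 : ℝ) ≤ s' := by positivity
    linarith
  | succ n ih =>
    have h := ih (b + w 0 + 1) (Fin.tail w)
    simp only [symbolLength, inverseSum]
    simp only [← add_assoc] at h
    set q : ℝ := ((s' + b + w 0 + 1 : ℕ) : ℝ) with hq
    set p : ℝ := ((s + b + w 0 + 1 : ℕ) : ℝ) with hp
    have hq0 : 0 < q := by positivity
    have hp0 : 0 < p := by positivity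
    have hpq : p ≤ q + s := by
      rw [hq, hp]
      push_cast
      have h3 : (0 : ℝ) ≤ s' := by positivity
      linarith
    have hexp : p ≤ q * Real.exp (s * (1 / q)) := by
      have h1 := mul_le_mul_of_nonneg_left (Real.add_one_le_exp ((s : ℝ) * (1 / q))) hq0.le
      have h2 : q * (s * (1 / q) + 1) = q + s := by
        field_simp
        ring
      linarith
    rw [mul_add, Real.exp_add, div_le_iff₀ hq0]
    refine h.trans ?_
    have hc := symbolLength_pos n (s + b + w 0 + 1) (Fin.tail w)
    calc _ = (1 + s) * Real.exp (s * inverseSum n (s' + b + w 0 + 1) (Fin.tail w)) *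
          (symbolLength n (s + b + w 0 + 1) (Fin.tail w) / p) * p := by
          field_simp
      _ ≤ (1 + s) * Real.exp (s * inverseSum n (s' + b + w 0 + 1) (Fin.tail w)) *
          (symbolLength n (s + b + w 0 + 1) (Fin.tail w) / p) * (q * Real.exp (s * (1 / q))) := by
          gcongr
      _ = _ := by ring

theorem tsum_ofReal_sub_le {f : ℕ → ℝ} (hf : Antitone f) (h0 : ∀ n, 0 ≤ f n) :
    ∑' n, ENNReal.ofReal (f n - f (n + 1)) ≤ ENNReal.ofReal (f 0) := by
  refine ENNReal.tsum_le_of_sum_range_le fun n => ?_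
  rw [← ENNReal.ofReal_sum_of_nonneg fun i _ => sub_nonneg.2 (hf i.le_succ),
    Finset.sum_range_sub']
  exact ENNReal.ofReal_le_ofReal (by linarith [h0 n])

theorem tsum_word_succ (n : ℕ) (f : (Fin (n + 1) → ℕ) → ENNReal) :
    ∑' w, f w = ∑' (a : ℕ) (w : Fin n → ℕ), f (Fin.cons a w) := by
  rw [← (Fin.consEquiv fun _ => ℕ).tsum_eq, ENNReal.tsum_prod']
  rfl

theorem tsum_symbolLength_le (n s : ℕ) :
    ∑' w, ENNReal.ofReal (symbolLength n s w) ≤ ENNReal.ofReal (1 / ((s : ℝ) + 1)) := by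
  simp only [← volume_symbolCylinder]
  rw [← measure_iUnion (fun _ _ h => disjoint_symbolCylinder s h) fun w => measurableSet_symbolCylinder n s w]
  refine (measure_mono (Set.iUnion_subset fun w => symbolCylinder_subset n s w)).trans ?_
  simp

/-- Conditioning on the first partial sum `q` bounds its contribution by `1 / (q ^ 2 * (q + 1)) + 1
/ (q * (q + 1) ^ 2) = 1 / q ^ 2 - 1 / (q + 1) ^ 2`, which telescopes. The bound is uniform in `n`.
-/
theorem tsum_symbolLength_mul_inverseSum_le (n s : ℕ) :
    ∑' w, ENNReal.ofReal (symbolLength n s w * inverseSum n s w) ≤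
      ENNReal.ofReal (1 / ((s : ℝ) + 1) ^ 2) := by
  induction n generalizing s with
  | zero => simp [inverseSum]
  | succ n ih =>
    have hf : Antitone fun a : ℕ => 1 / (((s + a : ℕ) : ℝ) + 1) ^ 2 := fun a b hab => by
      dsimp only
      gcongr
    refine le_trans ?_ ((tsum_ofReal_sub_le hf fun _ => by positivity).trans_eq (by simp))
    rw [tsum_word_succ]
    refine ENNReal.tsum_le_tsum fun a => ?_
    set q : ℝ := ((s + a + 1 : ℕ) : ℝ) with hq
    have hq0 : 0 < q := by positivity
    calc ∑' w : Fin n → ℕ, ENNReal.ofReal (symbolLength (n + 1) s (Fin.cons a w : Fin (n + 1) → ℕ)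
            * inverseSum (n + 1) s (Fin.cons a w : Fin (n + 1) → ℕ))
        = ∑' w : Fin n → ℕ, (ENNReal.ofReal (1 / q ^ 2) *
            ENNReal.ofReal (symbolLength n (s + a + 1) w) + ENNReal.ofReal (1 / q) *
            ENNReal.ofReal (symbolLength n (s + a + 1) w * inverseSum n (s + a + 1) w)) := by
          refine tsum_congr fun w => ?_
          have hl := (symbolLength_pos n (s + a + 1) w).le
          have hi := inverseSum_nonneg n (s + a + 1) w
          rw [← ENNReal.ofReal_mul (by positivity), ← ENNReal.ofReal_mul (by positivity),
            ← ENNReal.ofReal_add (by positivity) (by positivity)]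
          simp only [symbolLength, inverseSum, Fin.cons_zero, Fin.tail_cons, ← hq]
          congr 1
          field_simp
      _ ≤ ENNReal.ofReal (1 / q ^ 2) * ENNReal.ofReal (1 / (q + 1)) +
            ENNReal.ofReal (1 / q) * ENNReal.ofReal (1 / (q + 1) ^ 2) := by
          rw [ENNReal.tsum_add, ENNReal.tsum_mul_left, ENNReal.tsum_mul_left]
          gcongr
          · exact tsum_symbolLength_le n (s + a + 1)
          · exact ih (s + a + 1)
      _ ≤ _ := by
          rw [← ENNReal.ofReal_mul (by positivity), ← ENNReal.ofReal_mul (by positivity),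
            ← ENNReal.ofReal_add (by positivity) (by positivity)]
          refine ENNReal.ofReal_le_ofReal (le_of_eq ?_)
          have e1 : ((s + a : ℕ) : ℝ) + 1 = q := by rw [hq]; push_cast; ring
          have e2 : ((s + (a + 1) : ℕ) : ℝ) + 1 = q + 1 := by rw [hq]; push_cast; ring
          rw [e1, e2]
          field_simp
          ring

/-- Almost no number has an unbounded sum of inverses of the partial sums of its symbols. -/
theorem volume_unbounded_inverseSum (s : ℕ) :
    volume {x | ∃ u, x = offsetO1 s u ∧ ∀ M : ℕ, ∃ n, (M : ℝ) < inverseSum n s (seqPrefix n u)} =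
      0 := by
  have hH : ∀ u, Monotone fun n => inverseSum n s (seqPrefix n u) := fun u => by
    refine monotone_nat_of_le_succ fun n => ?_
    induction n generalizing s u with
    | zero => exact inverseSum_nonneg _ _ _
    | succ n ih =>
      rw [inverseSum, inverseSum.eq_2 s (n + 1), tail_seqPrefix, tail_seqPrefix]
      exact add_le_add_right (ih _ _) _
  have hM : ∀ M : ℕ, volume {x | ∃ u, x = offsetO1 s u ∧
      ∃ n, ((M + 1 : ℕ) : ℝ) < inverseSum n s (seqPrefix n u)} ≤ ((M + 1 : ℕ) : ENNReal)⁻¹ := by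
    intro M
    have hU : {x | ∃ u, x = offsetO1 s u ∧ ∃ n, ((M + 1 : ℕ) : ℝ) < inverseSum n s (seqPrefix n u)} =
        ⋃ n, {x | ∃ u, x = offsetO1 s u ∧
          ((M + 1 : ℕ) : ℝ) < inverseSum n s (seqPrefix n u)} := by
      ext x
      simp only [Set.mem_ofPred_eq, Set.mem_iUnion]
      tauto
    have hmono : Monotone fun n => {x | ∃ u, x = offsetO1 s u ∧
        ((M + 1 : ℕ) : ℝ) < inverseSum n s (seqPrefix n u)} := by
      rintro m n hmn x ⟨u, hx, hu⟩
      exact ⟨u, hx, hu.trans_le (hH u hmn)⟩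
    -- The sets increase with `n`, so a bound uniform in `n` passes to their union.
    rw [hU, hmono.measure_iUnion]
    refine iSup_le fun n => ?_
    have hsub : {x | ∃ u, x = offsetO1 s u ∧ ((M + 1 : ℕ) : ℝ) < inverseSum n s (seqPrefix n u)} ⊆
        ⋃ w : {w : Fin n → ℕ // ((M + 1 : ℕ) : ℝ) < inverseSum n s w}, symbolCylinder n s w := by
      rintro x ⟨u, rfl, hu⟩
      exact Set.mem_iUnion.2 ⟨⟨_, hu⟩, offsetO1_mem_symbolCylinder n s u⟩
    refine (measure_mono hsub).trans ((measure_iUnion_le _).trans ?_)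
    -- Markov's inequality over the cylinders of rank `n`.
    rw [ENNReal.le_inv_iff_mul_le, ← ENNReal.tsum_mul_right]
    calc ∑' w : {w : Fin n → ℕ // ((M + 1 : ℕ) : ℝ) < inverseSum n s w},
          volume (symbolCylinder n s w) * ((M + 1 : ℕ) : ENNReal)
        ≤ ∑' w : {w : Fin n → ℕ // ((M + 1 : ℕ) : ℝ) < inverseSum n s w},
          ENNReal.ofReal (symbolLength n s w * inverseSum n s w) := by
          refine ENNReal.tsum_le_tsum fun w => ?_
          rw [volume_symbolCylinder, ENNReal.ofReal_mul (symbolLength_pos _ _ _).le,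
            ← ENNReal.ofReal_natCast]
          gcongr
          exact w.2.le
      _ ≤ ∑' w : Fin n → ℕ, ENNReal.ofReal (symbolLength n s w * inverseSum n s w) :=
          ENNReal.tsum_comp_le_tsum_of_injective Subtype.val_injective _
      _ ≤ ENNReal.ofReal (1 / ((s : ℝ) + 1) ^ 2) := tsum_symbolLength_mul_inverseSum_le n s
      _ ≤ 1 := by
          rw [ENNReal.ofReal_le_one, div_le_one (by positivity)]
          have : (0 : ℝ) ≤ s := by positivity
          exact one_le_pow₀ (by linarith)
  refine le_antisymm (ge_of_tendsto' ((tendsto_add_atTop_iff_nat 1).2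
    ENNReal.tendsto_inv_nat_nhds_zero) fun M => le_trans (measure_mono ?_) (hM M)) bot_le
  rintro x ⟨u, hx, hu⟩
  exact ⟨u, hx, hu (M + 1)⟩

/-! ### Null sets under a change of offset. -/

theorem exists_symbolCylinder_subset {U : Set ℝ} (hU : IsOpen U) {s : ℕ} {u : ℕ → ℕ}
    (h : offsetO1 s u ∈ U) : ∃ n, symbolCylinder n s (seqPrefix n u) ⊆ U := by
  obtain ⟨ε, hε, hball⟩ := Metric.isOpen_iff.1 hU _ h
  obtain ⟨n, hn⟩ := exists_nat_one_div_lt hε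
  refine ⟨n, fun x hx => hball ?_⟩
  rw [Metric.mem_ball, Real.dist_eq]
  refine (abs_sub_le_of_mem_symbolCylinder hx (offsetO1_mem_symbolCylinder n s u)).trans_lt
    (((symbolLength_le _ _ _).trans ?_).trans_lt hn)
  refine one_div_le_one_div_of_le (by positivity) ?_
  have : (0 : ℝ) ≤ s := by positivity
  linarith

/-- The points of `U` are exhausted by the disjoint rank-`n` cylinders inside `U`; the bound `M`
makes the distortion of each of them uniform in `n`. -/
theorem volume_offsetO1_change_of_isOpen (s s' M : ℕ) {U : Set ℝ} (hU : IsOpen U) :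
    volume {x | ∃ u, x = offsetO1 s' u ∧ offsetO1 s u ∈ U ∧
      ∀ n, inverseSum n s' (seqPrefix n u) ≤ M} ≤
      ENNReal.ofReal ((1 + s) * Real.exp (s * M)) * volume U := by
  set B : ℕ → Set ℝ := fun n => {x | ∃ u, x = offsetO1 s' u ∧
    symbolCylinder n s (seqPrefix n u) ⊆ U ∧ ∀ n, inverseSum n s' (seqPrefix n u) ≤ M}
  have hB : Monotone B := monotone_nat_of_le_succ fun n => by
    rintro x ⟨u, hx, hu, hM⟩
    exact ⟨u, hx, (symbolCylinder_seqPrefix_succ_subset n s u).trans hu, hM⟩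
  have hsub : {x | ∃ u, x = offsetO1 s' u ∧ offsetO1 s u ∈ U ∧
      ∀ n, inverseSum n s' (seqPrefix n u) ≤ M} ⊆ ⋃ n, B n := by
    rintro x ⟨u, hx, hu, hM⟩
    obtain ⟨n, hn⟩ := exists_symbolCylinder_subset hU hu
    exact Set.mem_iUnion.2 ⟨n, u, hx, hn, hM⟩
  refine (measure_mono hsub).trans ?_
  rw [hB.measure_iUnion]
  refine iSup_le fun n => ?_
  let W := {w : Fin n → ℕ // symbolCylinder n s w ⊆ U ∧ inverseSum n s' w ≤ M}
  have hcov : B n ⊆ ⋃ w : W, symbolCylinder n s' w := by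
    rintro x ⟨u, rfl, hu, hM⟩
    exact Set.mem_iUnion.2 ⟨⟨_, hu, hM n⟩, offsetO1_mem_symbolCylinder n s' u⟩
  calc volume (B n) ≤ ∑' w : W, volume (symbolCylinder n s' w) :=
        (measure_mono hcov).trans (measure_iUnion_le _)
    _ ≤ ∑' w : W, ENNReal.ofReal ((1 + s) * Real.exp (s * M)) * volume (symbolCylinder n s w) := by
        refine ENNReal.tsum_le_tsum fun w => ?_
        rw [volume_symbolCylinder, volume_symbolCylinder, ← ENNReal.ofReal_mul (by positivity)]
        refine ENNReal.ofReal_le_ofReal ((symbolLength_le_mul_exp n s s' 0 w.1).trans ?_)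
        have := (symbolLength_pos n s w.1).le
        simp only [add_zero]
        gcongr
        exact w.2.2
    _ = ENNReal.ofReal ((1 + s) * Real.exp (s * M)) * volume (⋃ w : W, symbolCylinder n s w) := by
        rw [ENNReal.tsum_mul_left, measure_iUnion (fun _ _ h => disjoint_symbolCylinder s
          (Subtype.val_injective.ne h)) fun w => measurableSet_symbolCylinder n s w.1]
    _ ≤ _ := by
        gcongr
        exact Set.iUnion_subset fun w => w.2.1

/-- Changing the offset carries Lebesgue null sets to Lebesgue null sets. -/
theorem volume_offsetO1_change_eq_zero (s s' : ℕ) {A : Set ℝ} (hA : volume A = 0) :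
    volume {x | ∃ u, x = offsetO1 s' u ∧ offsetO1 s u ∈ A} = 0 := by
  have hgood : ∀ M : ℕ, volume {x | ∃ u, x = offsetO1 s' u ∧ offsetO1 s u ∈ A ∧
      ∀ n, inverseSum n s' (seqPrefix n u) ≤ M} = 0 := by
    intro M
    have hle : ∀ U ⊇ A, IsOpen U → volume {x | ∃ u, x = offsetO1 s' u ∧ offsetO1 s u ∈ A ∧
        ∀ n, inverseSum n s' (seqPrefix n u) ≤ M} ≤
          ENNReal.ofReal ((1 + s) * Real.exp (s * M)) * volume U := by
      intro U hAU hU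
      refine (measure_mono ?_).trans (volume_offsetO1_change_of_isOpen s s' M hU)
      rintro x ⟨u, hx, hu, hM⟩
      exact ⟨u, hx, hAU hu, hM⟩
    have hC : ENNReal.ofReal ((1 + s) * Real.exp (s * M)) ≠ 0 := by
      rw [Ne, ENNReal.ofReal_eq_zero, not_le]
      positivity
    refine le_antisymm (ENNReal.le_of_forall_pos_le_add fun ε hε _ => ?_) bot_le
    obtain ⟨U, hAU, hU, hlt⟩ := A.exists_isOpen_lt_of_lt
      (ε / ENNReal.ofReal ((1 + s) * Real.exp (s * M)))
      (hA ▸ ENNReal.div_pos (by exact_mod_cast hε.ne') ENNReal.ofReal_ne_top)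
    refine (hle U hAU hU).trans ?_
    rw [zero_add, mul_comm]
    exact ENNReal.mul_le_of_le_div hlt.le
  -- Sequences are split by whether their inverse sums are bounded by some `M`; the unbounded ones
  -- form a null set.
  refine measure_mono_null ?_ (measure_union_null (measure_iUnion_null hgood)
    (volume_unbounded_inverseSum s'))
  rintro x ⟨u, hx, hu⟩
  by_cases h : ∀ M : ℕ, ∃ n, (M : ℝ) < inverseSum n s' (seqPrefix n u)
  · exact Or.inr ⟨u, hx, h⟩
  · push Not at h
    obtain ⟨M, hM⟩ := h
    exact Or.inl (Set.mem_iUnion.2 ⟨M, u, hx, hu, hM⟩)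

/-! ### Invariant ideals and the zero-one law. -/

/-- A σ-ideal of sets of reals with measurable hulls that is invariant under rational affine maps
and under changes of the offset of Ostrogradsky series. -/
structure IsOffsetInvariantIdeal (𝒩 : Set ℝ → Prop) : Prop where
  exists_measurable_superset : ∀ A, 𝒩 A → ∃ B, A ⊆ B ∧ MeasurableSet B ∧ 𝒩 B
  iUnion : ∀ {ι : Type} [Countable ι] (A : ι → Set ℝ), (∀ i, 𝒩 (A i)) → 𝒩 (⋃ i, A i)
  affine : ∀ (a b : ℚ) (A : Set ℝ), b ≠ 0 → 𝒩 A → 𝒩 ((fun x : ℝ => a + b * x) ⁻¹' A)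
  change : ∀ (s s' : ℕ) (A : Set ℝ), 𝒩 A → 𝒩 {x | ∃ u, x = offsetO1 s' u ∧ offsetO1 s u ∈ A}

theorem isOffsetInvariantIdeal_countable : IsOffsetInvariantIdeal Set.Countable where
  exists_measurable_superset A hA := ⟨A, subset_rfl, hA.measurableSet, hA⟩
  iUnion _ h := Set.countable_iUnion h
  affine a b A hb hA := hA.preimage_of_injOn fun x _ y _ h => by
    have hb' : (b : ℝ) ≠ 0 := by exact_mod_cast hb
    simpa [hb'] using h
  change s s' A hA := by
    refine ((hA.preimage_of_injOn (f := offsetO1 s) (offsetO1_injective s).injOn).image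
      (offsetO1 s')).mono ?_
    rintro x ⟨u, rfl, hu⟩
    exact ⟨u, hu, rfl⟩

theorem isOffsetInvariantIdeal_volume :
    IsOffsetInvariantIdeal fun A : Set ℝ => volume A = 0 where
  exists_measurable_superset A hA := by
    obtain ⟨B, hAB, hB, h0⟩ := exists_measurable_superset_of_null hA
    exact ⟨B, hAB, hB, h0⟩
  iUnion _ h := measure_iUnion_null h
  affine a b A hb hA := by
    have hb' : (b : ℝ) ≠ 0 := by exact_mod_cast hb
    have h := Real.volume_preimage_mul_left hb' ((fun y : ℝ => a + y) ⁻¹' A)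
    rw [measure_preimage_add, hA, mul_zero] at h
    exact h
  change s s' _ hA := volume_offsetO1_change_eq_zero s s' hA

/-- The sequences such that infinitely many of their remainders have, for some offset, their value
in `G`. -/
def tailSet (G : Set ℝ) : Set (ℕ → ℕ) := {u | ∃ᶠ m in atTop, ∃ s, offsetO1 s (dropSeq m u) ∈ G}

/-- "Infinitely many `m`" allows the restriction to `m ≥ n`, and the quantifier over `s` removes the
sum of the deleted symbols; so the event is in the tail σ-algebra. -/
theorem tailSet_zero_or_one {Ω : Type*} [MeasurableSpace Ω] {P : Measure Ω} {η : ℕ → Ω → ℕ}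
    (hmeas : ∀ k, Measurable (η k)) (hindep : iIndepFun η P) {G : Set ℝ} (hG : MeasurableSet G) :
    P {ω | (fun k => η k ω) ∈ tailSet G} = 0 ∨ P {ω | (fun k => η k ω) ∈ tailSet G} = 1 := by
  refine measure_zero_or_one_of_measurableSet_limsup_atTop (fun k => (hmeas k).comap_le) hindep ?_
  rw [limsup_eq_iInf_iSup_of_nat, MeasurableSpace.measurableSet_iInf]
  intro n
  have hB : ∀ m ≥ n, MeasurableSet[⨆ i ≥ n, MeasurableSpace.comap (η i) ⊤]
      {ω | ∃ s, offsetO1 s (dropSeq m fun k => η k ω) ∈ G} := by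
    intro m hm
    have hd : Measurable[⨆ i ≥ n, MeasurableSpace.comap (η i) ⊤]
        fun ω => dropSeq m fun k => η k ω := by
      refine @measurable_pi_lambda _ _ _ (_) _ _ fun k => ?_
      refine (comap_measurable (η (m + k))).mono ?_ le_rfl
      exact le_iSup₂_of_le (m + k) (by omega) le_rfl
    have hU : {ω | ∃ s, offsetO1 s (dropSeq m fun k => η k ω) ∈ G} =
        ⋃ s, (fun ω => dropSeq m fun k => η k ω) ⁻¹' (offsetO1 s ⁻¹' G) := by
      ext ω
      simp
    rw [hU]
    exact MeasurableSet.iUnion fun s => hd (measurable_offsetO1 s hG)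
  have hE : {ω | (fun k => η k ω) ∈ tailSet G} =
      ⋂ k : ℕ, ⋃ m : {m // n ≤ m ∧ k ≤ m},
        {ω | ∃ s, offsetO1 s (dropSeq m.1 fun k => η k ω) ∈ G} := by
    ext ω
    simp only [tailSet, Set.mem_ofPred_eq, Set.mem_iInter, Set.mem_iUnion, frequently_atTop]
    constructor
    · intro h k
      obtain ⟨m, hm, hs⟩ := h (max n k)
      exact ⟨⟨m, (le_max_left _ _).trans hm, (le_max_right _ _).trans hm⟩, hs⟩
    · intro h k
      obtain ⟨m, hs⟩ := h k
      exact ⟨m, m.2.2, hs⟩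
  rw [hE]
  exact MeasurableSet.iInter fun k => MeasurableSet.iUnion fun m => hB m m.2.1

theorem IsOffsetInvariantIdeal.zero_or_concentrated {𝒩 : Set ℝ → Prop}
    (h𝒩 : IsOffsetInvariantIdeal 𝒩) {Ω : Type*} [MeasurableSpace Ω] {P : Measure Ω}
    [IsProbabilityMeasure P] {η : ℕ → Ω → ℕ}
    (hmeas : ∀ k, Measurable (η k)) (hindep : iIndepFun η P) {A : Set ℝ} (hA : MeasurableSet A)
    (h0 : 𝒩 A) :
    P.map (fun ω => offsetO1 0 fun k => η k ω) A = 0 ∨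
      ∃ N, 𝒩 N ∧ MeasurableSet N ∧ P.map (fun ω => offsetO1 0 fun k => η k ω) Nᶜ = 0 := by
  have hη : Measurable fun ω k => η k ω := measurable_pi_lambda _ hmeas
  have hV : Measurable fun ω => offsetO1 0 fun k => η k ω := (measurable_offsetO1 0).comp hη
  let I := {p : ℚ × ℚ // p.2 ≠ 0}
  set G : Set ℝ := ⋃ p : I, (fun x : ℝ => (p.1.1 : ℝ) + p.1.2 * x) ⁻¹' A with hG
  have hGm : MeasurableSet G := MeasurableSet.iUnion fun p => (by fun_prop : Measurable _) hA
  have hG0 : 𝒩 G := h𝒩.iUnion _ fun p => h𝒩.affine _ _ _ p.2 h0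
  have hAE : ∀ u, offsetO1 0 u ∈ A → u ∈ tailSet G := fun u hu => by
    refine Eventually.frequently (Eventually.of_forall fun m => ?_)
    obtain ⟨a, b, s, hb, h⟩ := exists_offsetO1_eq_affine m 0 u
    rw [h] at hu
    exact ⟨s, Set.mem_iUnion.2 ⟨⟨(a, b), hb⟩, hu⟩⟩
  rcases tailSet_zero_or_one hmeas hindep hGm with h | h
  · left
    rw [Measure.map_apply hV hA]
    exact measure_mono_null (fun ω hω => hAE _ hω) h
  · right
    -- The offset `s` that puts a remainder in `G` need not be the true offset `s'`: the ideal must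
    -- absorb the passage from `s` to `s'` and then the restoration of the deleted symbols.
    set N : Set ℝ := ⋃ p : ℕ × ℕ × I, (fun x : ℝ => (p.2.2.1.1 : ℝ) + p.2.2.1.2 * x) ⁻¹'
      {x | ∃ u, x = offsetO1 p.2.1 u ∧ offsetO1 p.1 u ∈ G} with hN
    have hN0 : 𝒩 N := h𝒩.iUnion _ fun p => h𝒩.affine _ _ _ p.2.2.2 (h𝒩.change _ _ _ hG0)
    have hEN : ∀ u ∈ tailSet G, offsetO1 0 u ∈ N := fun u hu => by
      obtain ⟨m, s, hs⟩ := Frequently.exists hu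
      obtain ⟨a, b, s', hb, h⟩ := exists_offsetO1_eq_affine m 0 u
      have hb' : (b : ℝ) ≠ 0 := by exact_mod_cast hb
      -- The pair `(-a / b, 1 / b)` is the inverse of `y ↦ a + b * y`.
      refine Set.mem_iUnion.2 ⟨(s, s', ⟨(-a / b, 1 / b), one_div_ne_zero hb⟩), dropSeq m u, ?_, hs⟩
      rw [h]
      push_cast
      field_simp
      ring
    obtain ⟨B, hNB, hB, hB0⟩ := h𝒩.exists_measurable_superset N hN0
    refine ⟨B, hB0, hB, ?_⟩
    rw [Measure.map_apply hV hB.compl, Set.preimage_compl, prob_compl_eq_zero_iff (hV hB)]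
    exact le_antisymm prob_le_one (h ▸ measure_mono fun ω hω => hNB (hEN _ hω))

/-! ### Purity of the law. -/

theorem IsPurelyDiscrete.not_noAtoms {μ : Measure ℝ} [NeZero μ] (h : IsPurelyDiscrete μ) :
    ¬ ∀ x, μ {x} = 0 := by
  intro h0
  obtain ⟨D, hD, hDc⟩ := h
  refine NeZero.ne μ (Measure.measure_univ_eq_zero.1 ?_)
  rw [← Set.union_compl_self D]
  exact measure_union_null ((measure_null_iff_singleton hD).2 fun x _ => h0 x) hDc

theorem mainTheorem1 {Ω : Type*} [MeasurableSpace Ω] (P : Measure Ω) [IsProbabilityMeasure P]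
    (ξ : ℕ → Ω → ℕ) (hmeas : ∀ k, Measurable (ξ k)) (hpos : ∀ k, ∀ᵐ ω ∂P, 0 < ξ k ω)
    (hindep : iIndepFun ξ P) (μ : Measure ℝ)
    (hμ : μ = P.map (fun ω => barO1 (fun k => ξ k ω))) :
    (IsPurelyDiscrete μ ∨ IsPurelySingularContinuous μ ∨ IsPurelyAbsolutelyContinuous μ) ∧
      ¬ (IsPurelyDiscrete μ ∧ IsPurelySingularContinuous μ) ∧
      ¬ (IsPurelyDiscrete μ ∧ IsPurelyAbsolutelyContinuous μ) ∧
      ¬ (IsPurelySingularContinuous μ ∧ IsPurelyAbsolutelyContinuous μ) := by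
  have hprob : IsProbabilityMeasure μ :=
    hμ ▸ Measure.isProbabilityMeasure_map (aemeasurable_barO1 hmeas hpos)
  have hpred : Measurable fun a : ℕ => a - 1 := measurable_from_nat
  have hη : ∀ k, Measurable fun ω => ξ k ω - 1 := fun k => hpred.comp (hmeas k)
  have hηi : iIndepFun (fun k ω => ξ k ω - 1) P :=
    hindep.comp (fun _ a => a - 1) fun _ => hpred
  have hμη : μ = P.map fun ω => offsetO1 0 fun k => ξ k ω - 1 := by
    rw [hμ]
    refine Measure.map_congr ?_
    filter_upwards [ae_all_iff.2 hpos] with ω hω using barO1_eq_offsetO1 hω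
  refine ⟨?_, fun h => h.1.not_noAtoms h.2.1, fun h => h.1.not_noAtoms fun x => h.2 (by simp),
    fun h => ?_⟩
  · have hDc : {x | 0 < μ {x}}.Countable :=
      Measure.countable_meas_pos_of_disjoint_iUnion (fun x => measurableSet_singleton x)
        fun x y hxy => by simpa using hxy
    -- Applied to the set of atoms: either there are none, or `μ` is discrete.
    rcases isOffsetInvariantIdeal_countable.zero_or_concentrated hη hηi hDc.measurableSet hDc with
      h | ⟨D, hD, -, hDμ⟩
    · right
      rw [← hμη] at h
      have hat : ∀ x, μ {x} = 0 := fun x => by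
        by_contra hx
        have hmem : x ∈ {x | 0 < μ {x}} := pos_iff_ne_zero.2 hx
        exact hx (measure_mono_null (Set.singleton_subset_iff.2 hmem) h)
      obtain ⟨S, hS, hS0, hSv⟩ := Measure.mutuallySingular_singularPart μ volume
      -- `Sᶜ` is a Lebesgue null set carrying the singular part: if it is `μ`-null, the singular
      -- part vanishes; otherwise a Lebesgue null set carries all of `μ`.
      rcases isOffsetInvariantIdeal_volume.zero_or_concentrated hη hηi hS.compl hSv with
        h | ⟨N, hN, hNm, hNμ⟩
      · right
        rw [← hμη] at h
        have hs : μ.singularPart volume = 0 := by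
          rw [← Measure.measure_univ_eq_zero, ← Set.union_compl_self S]
          exact measure_union_null hS0
            (le_antisymm ((Measure.singularPart_le μ volume _).trans h.le) bot_le)
        exact (Measure.singularPart_eq_zero μ volume).1 hs
      · left
        rw [← hμη] at hNμ
        exact ⟨hat, Nᶜ, hNm.compl, hNμ, by rwa [compl_compl]⟩
    · left
      exact ⟨D, hD, hμη ▸ hDμ⟩
  · exact NeZero.ne μ (Measure.eq_zero_of_absolutelyContinuous_of_mutuallySingular h.2 h.1.2)

end
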